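/- Let $K$ be a field and let $R = K\langle x,y\rangle/(xy-1)$ be the Toeplitz--Jacobson algebra. Put $f_1 = 1-yx$ and let $S_1 = Rf_1$ be the corresponding left ideal. There is a surjection of $K$-algebras $R\to K[x,x^{-1}]$ with $x\mapsto x$, $y\mapsto x^{-1}$; for a polynomial $p\in K[x]$ let $L_p = K[x,x^{-1}]/(p)$, viewed as a left $R$-module through this surjection, and let $p^*$ be the reversed polynomial, determined by $p^*(y) = p(x)\,y^{\deg p}\in K[y]\subseteq R$. All modules are left modules. (1) For every $R$-module $M$ of finite length there are $k\in\mathbb N$ and a short exact sequence of $R$-modules $0\to S_1^{\oplus k}\to M\to F\to 0$ with $F$ finite-dimensional over $K$. (2) Every $R$-module that is finite-dimensional over $K$ is isomorphic to a finite direct sum $L_{p_1}\oplus\dots\oplus L_{p_n}$ with nonzero (not necessarily irreducible) polynomials $p_i\in K[x]$. (3) For all nonzero $p\in K[x]$ and all $k\in\mathbb N$ there is a natural isomorphism of $K$-vector spaces $$\Theta_{p,k}:\ \operatorname{Ext}^1_R(L_p, S_1^{\oplus k})\ \xrightarrow{\ \cong\ }\ \bigl(K[T]/(p^*(T))\bigr)^{\oplus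 k}.$$ Explicitly, for a tuple $g=(g_1,\dots,g_k)\in K[T]^k$ write $g(y)f_1 = (g_1(y)f_1,\dots,g_k(y)f_1)\in S_1^{\oplus k}$. The isomorphisms $\Theta_{p,k}$ can be chosen such that: (a) if $0\to S_1^{\oplus k}\xrightarrow{\iota} E\xrightarrow{\pi} L_p\to 0$ is a short exact sequence of $R$-modules, $e\in E$ satisfies $\pi(e)=1$, and $p^*(y)\,e = \iota(g(y)f_1)$, then $\Theta_{p,k}$ sends the class of this extension to $g \bmod p^*$; (b) if $\alpha:S_1^{\oplus k}\to S_1^{\oplus l}$ is $R$-linear, $\alpha(g(y)f_1)=h(y)f_1$ and $\Theta_{p,k}(c)= g \bmod p^*$, then $\Theta_{p,l}(\alpha_*c)= h\bmod p^*$; (c) if $p,q$ are nonzero, $\beta:L_p\to L_q$ is $R$-linear with $\beta(1)=a(y)\cdot 1$, where $a,b\in K[T]$ satisfy $a\,p^* = b\,q^*$, and $\Theta_{q,k}(c)= g\bmod q^*$, then $\Theta_{p,k}(\beta^*c)= (b g_1,\dots,b g_k)\bmod p^*$. -/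

import Mathlib

open Polynomial CategoryTheory

universe u v w

noncomputable section

/-- The relation `x y = 1` on the free algebra on two letters; `x` is the letter `0` and `y` is the
letter `1`. -/
inductive JacobsonRel (K : Type u) [Field K] :
    FreeAlgebra K (Fin 2) → FreeAlgebra K (Fin 2) → Prop
  | xy : JacobsonRel K (FreeAlgebra.ι K 0 * FreeAlgebra.ι K 1) 1

/-- The Toeplitz-Jacobson algebra `R = K⟨x, y⟩ / (x y - 1)`. -/
def JacobsonAlgebra (K : Type u) [Field K] : Type u := RingQuot (JacobsonRel K)

namespace JacobsonAlgebra

variable (K : Type u) [Field K]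

instance : Ring (JacobsonAlgebra K) := inferInstanceAs (Ring (RingQuot (JacobsonRel K)))

instance : Algebra K (JacobsonAlgebra K) :=
  inferInstanceAs (Algebra K (RingQuot (JacobsonRel K)))

/-- The generator `x`. -/
def x : JacobsonAlgebra K := RingQuot.mkAlgHom K (JacobsonRel K) (FreeAlgebra.ι K 0)

/-- The generator `y`. -/
def y : JacobsonAlgebra K := RingQuot.mkAlgHom K (JacobsonRel K) (FreeAlgebra.ι K 1)

theorem x_mul_y : x K * y K = 1 := by
  have h := RingQuot.mkAlgHom_rel K (JacobsonRel.xy (K := K))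
  rw [map_mul, map_one] at h
  exact h

/-- The idempotent `f₁ = 1 - y x`. -/
def f₁ : JacobsonAlgebra K := 1 - y K * x K

/-- The simple left ideal `S₁ = R f₁`. -/
abbrev S₁ : Submodule (JacobsonAlgebra K) (JacobsonAlgebra K) :=
  Submodule.span (JacobsonAlgebra K) {f₁ K}

/-- The element `g(y) f₁` of `S₁`, for a polynomial `g`. -/
def polyS₁ (g : K[X]) : S₁ K :=
  ⟨aeval (y K) g * f₁ K, Submodule.smul_mem _ _ (Submodule.mem_span_singleton_self _)⟩

/-- The element `(g₁(y) f₁, …, g_k(y) f₁)` of `S₁^k`. -/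
def polyS₁Pow {k : ℕ} (g : Fin k → K[X]) : Fin k → S₁ K := fun i => polyS₁ K (g i)

/-- The quotient map from `R` to the Laurent polynomials, `x ↦ T` and `y ↦ T⁻¹`. -/
def toLaurent : JacobsonAlgebra K →ₐ[K] LaurentPolynomial K :=
  RingQuot.liftAlgHom K
    ⟨FreeAlgebra.lift K ![LaurentPolynomial.T 1, LaurentPolynomial.T (-1)], by
      rintro _ _ ⟨⟩
      rw [map_mul, map_one, FreeAlgebra.lift_ι_apply, FreeAlgebra.lift_ι_apply]
      exact (LaurentPolynomial.T_add 1 (-1)).symm.trans LaurentPolynomial.T_zero⟩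

@[simp]
theorem toLaurent_x : toLaurent K (x K) = LaurentPolynomial.T 1 := by
  rw [toLaurent, x]
  exact (RingQuot.liftAlgHom_mkAlgHom_apply _ _ _ _).trans (by simp)

@[simp]
theorem toLaurent_y : toLaurent K (y K) = LaurentPolynomial.T (-1) := by
  rw [toLaurent, y]
  exact (RingQuot.liftAlgHom_mkAlgHom_apply _ _ _ _).trans (by simp)

variable {K}

/-- `L_p = K[x, x⁻¹] / (p)`, for a polynomial `p` in `x`. -/
def L (p : K[X]) : Type u :=
  LaurentPolynomial K ⧸ Ideal.span {Polynomial.toLaurent p}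

instance (p : K[X]) : AddCommGroup (L p) :=
  inferInstanceAs (AddCommGroup (LaurentPolynomial K ⧸ Ideal.span {Polynomial.toLaurent p}))

/-- `L_p` is an `R`-module through the quotient map from `R` to `K[x, x⁻¹]`. -/
instance (p : K[X]) : Module (JacobsonAlgebra K) (L p) :=
  Module.compHom (LaurentPolynomial K ⧸ Ideal.span {Polynomial.toLaurent p})
    (toLaurent K).toRingHom

/-- The class of a Laurent polynomial in `L_p`. -/
def L.mk (p : K[X]) (g : LaurentPolynomial K) : L p := Ideal.Quotient.mk _ g

theorem L.smul_mk (p : K[X]) (r : JacobsonAlgebra K) (g : LaurentPolynomial K) :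
    r • L.mk p g = L.mk p (toLaurent K r * g) := rfl

/-- The reversed polynomial `p*`. -/
abbrev pStar (p : K[X]) : K[X] := p.reverse

/-- `p*` is characterised by `p*(y) = p(x) y ^ deg p` in `R`. -/
theorem aeval_pStar (p : K[X]) :
    aeval (y K) (pStar p) = aeval (x K) p * y K ^ p.natDegree := by
  have hxy : ∀ i : ℕ, x K ^ i * y K ^ i = 1 := by
    intro i
    induction i with
    | zero => simp
    | succ i ih =>
      rw [pow_succ, pow_succ', mul_assoc, ← mul_assoc (x K) (y K), x_mul_y, one_mul, ih]
  have hlt : (pStar p).natDegree < p.natDegree + 1 :=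
    Nat.lt_succ_of_le (reverse_natDegree_le p)
  rw [aeval_eq_sum_range' hlt, aeval_eq_sum_range, Finset.sum_mul,
    ← Finset.sum_range_reflect]
  refine Finset.sum_congr rfl fun i hi => ?_
  have hi' : i ≤ p.natDegree := Nat.lt_succ_iff.mp (Finset.mem_range.mp hi)
  have e1 : p.natDegree + 1 - 1 - i = p.natDegree - i := by omega
  have e2 : y K ^ p.natDegree = y K ^ i * y K ^ (p.natDegree - i) := by
    rw [← pow_add, Nat.add_sub_cancel' hi']
  rw [e1, coeff_reverse, revAt_le (Nat.sub_le _ _), Nat.sub_sub_self hi', smul_mul_assoc, e2,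
    ← mul_assoc, hxy, one_mul]

/-- `(K[T] / (p*(T)))^k`. -/
abbrev StarQuot (p : K[X]) (k : ℕ) : Type u := Fin k → K[X] ⧸ Ideal.span {pStar p}

/-- The class in `(K[T] / (p*(T)))^k` of a tuple of polynomials. -/
def StarQuot.mk (p : K[X]) {k : ℕ} (g : Fin k → K[X]) : StarQuot p k :=
  fun i => Ideal.Quotient.mk _ (g i)

variable (K) in
/-- `S₁^k` as an object of the category of left `R`-modules. -/
abbrev SObj (k : ℕ) : ModuleCat.{u} (JacobsonAlgebra K) :=
  ModuleCat.of (JacobsonAlgebra K) (Fin k → S₁ K)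

/-- `L_p` as an object of the category of left `R`-modules. -/
abbrev LObj (p : K[X]) : ModuleCat.{u} (JacobsonAlgebra K) :=
  ModuleCat.of (JacobsonAlgebra K) (L p)

end JacobsonAlgebra

end

/-!
The Toeplitz representation of `R` on `K[X]`, with `y` the shift and `x` the backward shift, is
isomorphic to `S₁` through `g ↦ g(y) f₁`, and it is simple because applying the backward shift
`deg g` times turns a nonzero `g` into a nonzero constant. Since `f₁ m` lies in an image of `S₁`,
dividing a module of finite length by its `S₁`-isotypic component leaves a module killed by `f₁`,
which is the same as a module over `K[x, x⁻¹]`; there finite length forces finite dimension by the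
Nullstellensatz. On a finite-dimensional module `x y = 1` implies `y x = 1`, so `f₁` acts as zero,
and the structure theorem over the principal ideal domain `K[x, x⁻¹]` applies.

Right multiplication by `p*(y)` gives a free resolution `0 → R → R → L_p → 0`, because the kernel of
`R → K[x, x⁻¹]` consists of elements killed by a power of `y`, which is coprime to `p*(y)`. Hence
`Ext¹(L_p, N) = N / p*(y) N`, and for `N = S₁^k` this is `(K[T] / p*)^k`. Lifting morphisms to these
resolutions gives the explicit formulas.
-/

noncomputable section

section FiniteModules

variable {K : Type*} [CommRing K] {A : Type*} [CommRing A] [Algebra K A]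
  {M : Type*} [AddCommGroup M] [Module A M] [hK : Module K M] [hKA : IsScalarTower K A M]

theorem finite_of_isSimpleModule [IsJacobsonRing K] [Algebra.FiniteType K A] [IsSimpleModule A M] :
    Module.Finite K M := by
  obtain ⟨I, hI, ⟨e⟩⟩ := isSimpleModule_iff_quot_maximal.1 ‹IsSimpleModule A M›
  let := Ideal.Quotient.field I
  have := finite_of_finite_type_of_isJacobsonRing K (A ⧸ I)
  exact Module.Finite.equiv (e.restrictScalars K).symm

theorem isTorsion_of_finite_of_not_finite [IsNoetherianRing K] [IsDomain A] [Module.Finite K M]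
    (hA : ¬ Module.Finite K A) : Module.IsTorsion A M := by
  intro m
  by_contra h
  refine hA (Module.Finite.of_injective ((LinearMap.toSpanSingleton A M m).restrictScalars K) ?_)
  refine (injective_iff_map_eq_zero _).2 fun a ha => ?_
  by_contra ha0
  exact h ⟨⟨a, mem_nonZeroDivisors_of_ne_zero ha0⟩, ha⟩

theorem finite_of_isFiniteLength [IsJacobsonRing K] [Algebra.FiniteType K A]
    (h : IsFiniteLength A M) : Module.Finite K M := by
  induction h generalizing hK hKA with
  | of_subsingleton => infer_instance
  | @of_simple_quotient M _ _ N _ _ ih =>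
    have : Module.Finite K (N.restrictScalars K) := ih
    have : Module.Finite K (M ⧸ N) := finite_of_isSimpleModule (A := A)
    have : Module.Finite K (M ⧸ N.restrictScalars K) := this
    exact Module.Finite.of_submodule_quotient (N.restrictScalars K)

end FiniteModules

section KernelQuotient

variable {R M N P : Type*} [Ring R] [AddCommGroup M] [AddCommGroup N] [AddCommGroup P]
  [Module R M] [Module R N] [Module R P]

/-- The isomorphism between the targets of two surjective linear maps with the same kernel. -/
def linearEquivOfKerEq (f : M →ₗ[R] N) (g : M →ₗ[R] P) (hf : Function.Surjective f)
    (hg : Function.Surjective g) (h : LinearMap.ker f = LinearMap.ker g) : N ≃ₗ[R] P :=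
  (f.quotKerEquivOfSurjective hf).symm ≪≫ₗ Submodule.quotEquivOfEq _ _ h ≪≫ₗ
    g.quotKerEquivOfSurjective hg

@[simp]
theorem linearEquivOfKerEq_apply {f : M →ₗ[R] N} {g : M →ₗ[R] P} (hf : Function.Surjective f)
    (hg : Function.Surjective g) (h : LinearMap.ker f = LinearMap.ker g) (m : M) :
    linearEquivOfKerEq f g hf hg h (f m) = g m := by
  simp [linearEquivOfKerEq, LinearMap.quotKerEquivOfSurjective_symm_apply]

end KernelQuotient

section PrincipalIdealDomain

theorem isPrincipalIdealRing_of_isLocalization {R : Type*} [CommRing R] [IsPrincipalIdealRing R]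
    (S : Submonoid R) (A : Type*) [CommRing A] [Algebra R A] [IsLocalization S A] :
    IsPrincipalIdealRing A where
  principal I := by
    obtain ⟨g, hg⟩ := IsPrincipalIdealRing.principal (I.under R)
    refine ⟨algebraMap R A g, ?_⟩
    rw [← IsLocalization.map_under S A I, hg]
    exact (Ideal.map_span _ _).trans (by rw [Set.image_singleton])

theorem exists_linearEquiv_pi_quotient_of_isTorsion {A : Type*} [CommRing A] [IsDomain A]
    [IsPrincipalIdealRing A] {M : Type*} [AddCommGroup M] [Module A M] [Module.Finite A M]
    (hM : Module.IsTorsion A M) :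
    ∃ (n : ℕ) (q : Fin n → A), (∀ i, q i ≠ 0) ∧ Nonempty (M ≃ₗ[A] ∀ i, A ⧸ Ideal.span {q i}) := by
  classical
  obtain ⟨ι, _, q, hq, e, ⟨E⟩⟩ := Module.equiv_directSum_of_isTorsion hM
  let σ := (Fintype.equivFin ι).symm
  exact ⟨Fintype.card ι, fun j => q (σ j) ^ e (σ j), fun j => pow_ne_zero _ (hq _).ne_zero,
    ⟨E ≪≫ₗ DirectSum.linearEquivFunOnFintype _ _ _ ≪≫ₗ
      (LinearEquiv.piCongrLeft A (fun i => A ⧸ Ideal.span {q i ^ e i}) σ).symm⟩⟩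

end PrincipalIdealDomain

section LaurentPolynomial

variable {K : Type*} [Field K]

instance : IsPrincipalIdealRing (LaurentPolynomial K) :=
  isPrincipalIdealRing_of_isLocalization (.powers (X : K[X])) _

theorem not_finite_laurentPolynomial : ¬ Module.Finite K (LaurentPolynomial K) := fun _ =>
  Polynomial.not_finite (R := K) <|
    Module.Finite.of_injective toLaurentAlg.toLinearMap Polynomial.toLaurent_injective

theorem exists_span_toLaurent_eq {q : LaurentPolynomial K} (hq : q ≠ 0) :
    ∃ p : K[X], p ≠ 0 ∧ Ideal.span {Polynomial.toLaurent p} = Ideal.span {q} := by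
  obtain ⟨n, p, hp⟩ := LaurentPolynomial.exists_T_pow q
  have hT := LaurentPolynomial.isUnit_T (R := K) n
  refine ⟨p, ?_, hp ▸ Ideal.span_singleton_mul_right_unit hT q⟩
  rw [← Polynomial.toLaurent_ne_zero, hp]
  exact fun h => hq (hT.mul_left_eq_zero.1 h)

theorem exists_linearEquiv_pi_quotient_toLaurent {F : Type*} [AddCommGroup F] [Module K F]
    [Module (LaurentPolynomial K) F] [IsScalarTower K (LaurentPolynomial K) F]
    [Module.Finite K F] :
    ∃ (n : ℕ) (p : Fin n → K[X]), (∀ i, p i ≠ 0) ∧ Nonempty (F ≃ₗ[LaurentPolynomial K]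
      ∀ i, LaurentPolynomial K ⧸ Ideal.span {Polynomial.toLaurent (p i)}) := by
  have : Module.Finite (LaurentPolynomial K) F := Module.Finite.of_restrictScalars_finite K _ _
  have hF : Module.IsTorsion (LaurentPolynomial K) F :=
    isTorsion_of_finite_of_not_finite not_finite_laurentPolynomial
  obtain ⟨n, q, hq, ⟨e⟩⟩ := exists_linearEquiv_pi_quotient_of_isTorsion hF
  choose p hp hpq using fun i => exists_span_toLaurent_eq (hq i)
  exact ⟨n, p, hp, ⟨e ≪≫ₗ .piCongrRight fun i => Submodule.quotEquivOfEq _ _ (hpq i).symm⟩⟩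

end LaurentPolynomial

section OneRelator

variable {R : Type u} [Ring R]

/-- The morphism `R ⟶ M` in the category of left `R`-modules which sends `1` to `m`. -/
def elementHom {M : ModuleCat.{u} R} (m : M) : ModuleCat.of R R ⟶ M :=
  ModuleCat.ofHom (LinearMap.toSpanSingleton R M m)

section ElementHom

variable {M N : ModuleCat.{u} R}

@[simp]
theorem elementHom_apply (m : M) (r : R) : (elementHom m).hom r = r • m := rfl

theorem elementHom_hom_one (f : ModuleCat.of R R ⟶ M) : elementHom (f.hom (1 : R)) = f :=
  ModuleCat.hom_ext (LinearMap.ext_ring (one_smul R _))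

theorem elementHom_comp (m : M) (f : M ⟶ N) : elementHom m ≫ f = elementHom (f.hom m) :=
  ModuleCat.hom_ext (LinearMap.ext fun r => map_smul f.hom r m)

theorem elementHom_add (m n : M) : elementHom (m + n) = elementHom m + elementHom n :=
  ModuleCat.hom_ext (LinearMap.toSpanSingleton_add m n)

theorem elementHom_algebraMap_smul {K : Type v} [Field K] [Algebra K R] (c : K) (m : M) :
    elementHom (algebraMap K R c • m) = c • elementHom m :=
  ModuleCat.hom_ext (LinearMap.ext_ring (one_smul R _ |>.trans
    (congrArg (algebraMap K R c • ·) (one_smul R m).symm)))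

theorem elementHom_injective : Function.Injective (elementHom (M := M)) := fun m n h =>
  (one_smul R m).symm.trans ((congrArg (fun f => f.hom (1 : R)) h).trans (one_smul R n))

end ElementHom

/-- `m` generates its module subject to the single relation `a • m = 0`: with a right regular `a`,
this means that `r ↦ r * a` and `r ↦ r • m` form a short exact sequence `0 → R → R → M → 0`. -/
structure IsOneRelator {M : Type*} [AddCommGroup M] [Module R M] (a : R) (m : M) : Prop where
  isRightRegular : IsRightRegular a
  surjective : Function.Surjective (LinearMap.toSpanSingleton R M m)
  smul_eq_zero_iff : ∀ r : R, r • m = 0 ↔ ∃ s, s * a = r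

namespace IsOneRelator

variable {M M' N N' : ModuleCat.{u} R} {a a' : R} {m : M} {m' : M'}

theorem relation (h : IsOneRelator a m) : a • m = 0 :=
  (h.smul_eq_zero_iff a).2 ⟨1, one_mul a⟩

/-- The sequence `R → R → M` of a one-relator presentation, as a short complex. -/
abbrev resolution (h : IsOneRelator a m) : ShortComplex (ModuleCat.{u} R) :=
  ShortComplex.mk (elementHom (M := ModuleCat.of R R) a) (elementHom m) <| by
    rw [elementHom_comp, elementHom_apply, h.relation]
    exact ModuleCat.hom_ext (LinearMap.toSpanSingleton_zero R M)

theorem shortExact (h : IsOneRelator a m) : h.resolution.ShortExact where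
  exact := (ShortComplex.moduleCat_exact_iff _).2 fun r hr => (h.smul_eq_zero_iff r).1 hr
  mono_f := (ModuleCat.mono_iff_injective _).2 h.isRightRegular
  epi_g := (ModuleCat.epi_iff_surjective _).2 h.surjective

/-- The extension class of `M` by `N` attached to `n : N`: the pushout of the resolution
`0 → R → R → M → 0` along the map `R → N` sending `1` to `n`. -/
def extMk (h : IsOneRelator a m) (n : N) : Abelian.Ext M N 1 :=
  h.shortExact.extClass.comp (Abelian.Ext.mk₀ (elementHom n)) (add_zero 1)

theorem extMk_add (h : IsOneRelator a m) (n₁ n₂ : N) :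
    h.extMk (n₁ + n₂) = h.extMk n₁ + h.extMk n₂ := by
  rw [extMk, elementHom_add, Abelian.Ext.mk₀_add, Abelian.Ext.comp_add, extMk, extMk]

theorem extMk_algebraMap_smul {K : Type v} [Field K] [Algebra K R] (h : IsOneRelator a m)
    (c : K) (n : N) : h.extMk (algebraMap K R c • n) = c • h.extMk n := by
  rw [extMk, elementHom_algebraMap_smul, Abelian.Ext.mk₀_smul, Abelian.Ext.comp_smul, extMk]

theorem extMk_surjective (h : IsOneRelator a m) : Function.Surjective (h.extMk (N := N)) := by
  intro c
  have : Projective h.resolution.X₂ := (IsProjective.iff_projective R).1 inferInstance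
  obtain ⟨c', rfl⟩ := Abelian.Ext.contravariant_sequence_exact₃ h.shortExact N c
    (Abelian.Ext.eq_zero_of_projective _) (add_zero 1)
  obtain ⟨f, rfl⟩ := Abelian.Ext.addEquiv₀.symm.surjective c'
  refine ⟨f.hom (1 : R), ?_⟩
  rw [extMk, elementHom_hom_one]
  rfl

theorem extMk_smul (h : IsOneRelator a m) (n : N) : h.extMk (a • n) = 0 := by
  rw [extMk, ← elementHom_apply n a, ← elementHom_comp, ← Abelian.Ext.mk₀_comp_mk₀]
  exact h.shortExact.extClass_comp_assoc _

theorem extMk_eq_zero_iff (h : IsOneRelator a m) {n : N} :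
    h.extMk n = 0 ↔ ∃ n', a • n' = n := by
  refine ⟨fun hn => ?_, fun ⟨n', hn'⟩ => hn' ▸ h.extMk_smul n'⟩
  obtain ⟨c, hc⟩ := Abelian.Ext.contravariant_sequence_exact₁ h.shortExact N _ (add_zero 1) hn
  obtain ⟨f, rfl⟩ := Abelian.Ext.addEquiv₀.symm.surjective c
  obtain ⟨n', rfl⟩ : ∃ n', elementHom n' = f := ⟨_, elementHom_hom_one f⟩
  have hf : h.resolution.f ≫ elementHom n' = elementHom n :=
    Abelian.Ext.addEquiv₀.symm.injective ((Abelian.Ext.mk₀_comp_mk₀ _ _).symm.trans hc)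
  refine ⟨n', elementHom_injective ?_⟩
  rw [← hf, elementHom_comp, elementHom_apply]

theorem extMk_comp_mk₀ (h : IsOneRelator a m) (n : N) (f : N ⟶ N') :
    (h.extMk n).comp (Abelian.Ext.mk₀ f) (add_zero 1) = h.extMk (f.hom n) := by
  rw [extMk, Abelian.Ext.comp_assoc_of_third_deg_zero, Abelian.Ext.mk₀_comp_mk₀,
    elementHom_comp, extMk]

theorem mk₀_comp_extMk (h : IsOneRelator a m) (h' : IsOneRelator a' m') {f : M ⟶ M'} {b c : R}
    (hf : f.hom m = c • m') (hbc : b * a' = a * c) (n : N) :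
    (Abelian.Ext.mk₀ f).comp (h'.extMk n) (zero_add 1) = h.extMk (b • n) := by
  let φ : h.resolution ⟶ h'.resolution :=
    { τ₁ := elementHom (M := ModuleCat.of R R) b
      τ₂ := elementHom (M := ModuleCat.of R R) c
      τ₃ := f
      comm₁₂ := by
        rw [elementHom_comp, elementHom_comp]
        exact congrArg (elementHom (M := ModuleCat.of R R)) hbc
      comm₂₃ := by rw [elementHom_comp, elementHom_comp, hf, elementHom_apply] }
  have hφ : h.shortExact.extClass.comp (Abelian.Ext.mk₀ φ.τ₁) (add_zero 1) =
      (Abelian.Ext.mk₀ f).comp h'.shortExact.extClass (zero_add 1) :=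
    h.shortExact.extClass_naturality h'.shortExact φ
  rw [extMk, extMk, ← Abelian.Ext.comp_assoc (a₁₂ := 1) _ _ _ (by lia) (by lia) (by lia), ← hφ,
    Abelian.Ext.comp_assoc_of_third_deg_zero, Abelian.Ext.mk₀_comp_mk₀, elementHom_comp,
    elementHom_apply]

theorem extClass_eq_extMk (h : IsOneRelator a m) {E : ModuleCat.{u} R} {ι : N ⟶ E} {π : E ⟶ M}
    {hιπ : ι ≫ π = 0} (hE : (ShortComplex.mk ι π hιπ).ShortExact) {e : E} {n : N}
    (he : π.hom e = m) (hn : ι.hom n = a • e) : hE.extClass = h.extMk n := by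
  let φ : h.resolution ⟶ ShortComplex.mk ι π hιπ :=
    { τ₁ := elementHom n
      τ₂ := elementHom e
      τ₃ := 𝟙 M
      comm₁₂ := by rw [elementHom_comp, elementHom_comp, hn, elementHom_apply]
      comm₂₃ := by rw [elementHom_comp, he, Category.comp_id] }
  exact (Abelian.Ext.mk₀_id_comp _).symm.trans (h.shortExact.extClass_naturality hE φ).symm

end IsOneRelator

end OneRelator

namespace JacobsonAlgebra

section Representations

variable {K : Type u} [Field K]

theorem induction {P : JacobsonAlgebra K → Prop} (r : JacobsonAlgebra K)
    (algebraMap : ∀ c : K, P (algebraMap K _ c)) (x : P (x K)) (y : P (y K))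
    (add : ∀ r s, P r → P s → P (r + s)) (mul : ∀ r s, P r → P s → P (r * s)) : P r := by
  obtain ⟨a, rfl⟩ := RingQuot.mkAlgHom_surjective K (JacobsonRel K) r
  induction a using FreeAlgebra.induction with
  | grade0 c => exact ((RingQuot.mkAlgHom K (JacobsonRel K)).commutes c).symm ▸ algebraMap c
  | grade1 i =>
    fin_cases i
    exacts [x, y]
  | mul a b ha hb => exact (map_mul (RingQuot.mkAlgHom K (JacobsonRel K)) a b).symm ▸ mul _ _ ha hb
  | add a b ha hb => exact (map_add (RingQuot.mkAlgHom K (JacobsonRel K)) a b).symm ▸ add _ _ ha hb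

/-- The homomorphism out of the Toeplitz–Jacobson algebra determined by a pair `a * b = 1`. -/
def lift {A : Type*} [Semiring A] [Algebra K A] (a b : A) (h : a * b = 1) :
    JacobsonAlgebra K →ₐ[K] A :=
  RingQuot.liftAlgHom K ⟨FreeAlgebra.lift K ![a, b], by rintro _ _ ⟨⟩; simpa using h⟩

@[simp]
theorem lift_x {A : Type*} [Semiring A] [Algebra K A] {a b : A} (h : a * b = 1) :
    lift a b h (x K) = a :=
  (RingQuot.liftAlgHom_mkAlgHom_apply _ _ _ _).trans (by simp)

@[simp]
theorem lift_y {A : Type*} [Semiring A] [Algebra K A] {a b : A} (h : a * b = 1) :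
    lift a b h (y K) = b :=
  (RingQuot.liftAlgHom_mkAlgHom_apply _ _ _ _).trans (by simp)

variable (K) in
/-- The Toeplitz representation on `K[X]`: `y` is the shift `g ↦ X * g` and `x` is the backward
shift `g ↦ (g - g(0)) / X`. -/
def toeplitz : JacobsonAlgebra K →ₐ[K] Module.End K K[X] :=
  lift
    { toFun := divX
      map_add' := fun _ _ => divX_add
      map_smul' := fun c g => by simp [smul_eq_C_mul, divX_C_mul] }
    (Algebra.lmul K K[X] X) (LinearMap.ext fun g => by ext; simp [coeff_divX])

@[simp]
theorem toeplitz_x (g : K[X]) : toeplitz K (x K) g = divX g := by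
  rw [toeplitz, lift_x]
  rfl

theorem toeplitz_aeval_y (q g : K[X]) : toeplitz K (aeval (y K) q) g = q * g := by
  rw [← aeval_algHom_apply, toeplitz, lift_y, aeval_algHom_apply, aeval_X_left_apply]
  rfl

@[simp]
theorem toeplitz_y (g : K[X]) : toeplitz K (y K) g = X * g := by
  simpa using toeplitz_aeval_y X g

theorem toeplitz_x_pow_natDegree (g : K[X]) :
    toeplitz K (x K ^ g.natDegree) g = C g.leadingCoeff := by
  have coeff_x_pow (n i : ℕ) : (toeplitz K (x K ^ n) g).coeff i = g.coeff (i + n) := by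
    induction n generalizing i with
    | zero => simp
    | succ n ih => rw [pow_succ', map_mul, Module.End.mul_apply, toeplitz_x, coeff_divX, ih,
        add_right_comm, add_assoc]
  ext i
  rw [coeff_x_pow, coeff_C]
  split_ifs with hi
  · rw [hi, zero_add, leadingCoeff]
  · exact coeff_eq_zero_of_natDegree_lt (by lia)

theorem exists_toeplitz_eq {g : K[X]} (hg : g ≠ 0) (h : K[X]) : ∃ r, toeplitz K r g = h := by
  refine ⟨aeval (y K) (h * C g.leadingCoeff⁻¹) * x K ^ g.natDegree, ?_⟩
  rw [map_mul, Module.End.mul_apply, toeplitz_x_pow_natDegree, toeplitz_aeval_y, mul_assoc,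
    ← C_mul, inv_mul_cancel₀ (leadingCoeff_ne_zero.2 hg), C_1, mul_one]

end Representations

section SimpleIdeal

variable {K : Type u} [Field K]

theorem x_mul_f₁ : x K * f₁ K = 0 := by
  rw [f₁, mul_sub, ← mul_assoc, x_mul_y, mul_one, one_mul, sub_self]

theorem polyS₁_add (g h : K[X]) : polyS₁ K (g + h) = polyS₁ K g + polyS₁ K h :=
  Subtype.ext (by simp [polyS₁, add_mul])

theorem polyS₁_mul (q g : K[X]) : polyS₁ K (q * g) = aeval (y K) q • polyS₁ K g :=
  Subtype.ext (by simp [polyS₁, mul_assoc])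

theorem polyS₁_C_mul (c : K) (g : K[X]) :
    polyS₁ K (C c * g) = algebraMap K (JacobsonAlgebra K) c • polyS₁ K g := by
  rw [polyS₁_mul, aeval_C]

theorem polyS₁_divX (g : K[X]) : polyS₁ K (divX g) = x K • polyS₁ K g := by
  have hC (c : K) : x K • polyS₁ K (C c) = 0 :=
    Subtype.ext <| by simp [polyS₁, Algebra.left_comm, x_mul_f₁]
  conv_rhs => rw [← X_mul_divX_add g, polyS₁_add, polyS₁_mul, aeval_X, smul_add, hC, ← mul_smul,
    x_mul_y, one_smul, add_zero]

theorem polyS₁_toeplitz (r : JacobsonAlgebra K) (g : K[X]) :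
    polyS₁ K (toeplitz K r g) = r • polyS₁ K g := by
  induction r using induction generalizing g with
  | algebraMap c => rw [← polyS₁_C_mul, ← smul_eq_C_mul, AlgHom.commutes]; rfl
  | x => rw [toeplitz_x, polyS₁_divX]
  | y => rw [toeplitz_y, polyS₁_mul, aeval_X]
  | add r s hr hs => rw [map_add, LinearMap.add_apply, polyS₁_add, hr, hs, add_smul]
  | mul r s hr hs => rw [map_mul, Module.End.mul_apply, hr, hs, mul_smul]

theorem toeplitz_polyS₁ (g : K[X]) : toeplitz K (polyS₁ K g) 1 = g := by
  simp [polyS₁, f₁, toeplitz_aeval_y, divX_one]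

theorem polyS₁_injective : Function.Injective (polyS₁ K) :=
  Function.LeftInverse.injective (g := fun s : S₁ K => toeplitz K s 1) toeplitz_polyS₁

theorem polyS₁_surjective : Function.Surjective (polyS₁ K) := by
  rintro ⟨s, hs⟩
  obtain ⟨r, rfl⟩ := Submodule.mem_span_singleton.1 hs
  exact ⟨toeplitz K r 1, Subtype.ext (by rw [polyS₁_toeplitz]; simp [polyS₁])⟩

instance isSimpleModule_S₁ : IsSimpleModule (JacobsonAlgebra K) (S₁ K) := by
  refine isSimpleModule_iff_toSpanSingleton_surjective.2 ⟨polyS₁_injective.nontrivial, ?_⟩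
  intro s hs t
  obtain ⟨g, rfl⟩ := polyS₁_surjective s
  obtain ⟨h, rfl⟩ := polyS₁_surjective t
  have hg : g ≠ 0 := fun h0 => hs (by simp [h0, polyS₁])
  obtain ⟨r, rfl⟩ := exists_toeplitz_eq hg h
  exact ⟨r, (polyS₁_toeplitz r g).symm⟩

end SimpleIdeal

section Laurent

variable {K : Type u} [Field K]

theorem toLaurent_aeval_x (g : K[X]) : toLaurent K (aeval (x K) g) = Polynomial.toLaurent g := by
  rw [← aeval_algHom_apply, toLaurent_x, ← toLaurent_X, ← coe_toLaurentAlg, aeval_algHom_apply,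
    aeval_X_left_apply]

theorem toLaurent_aeval_y (g : K[X]) :
    toLaurent K (aeval (y K) g) = LaurentPolynomial.invert (Polynomial.toLaurent g) := by
  rw [← aeval_algHom_apply, toLaurent_y, ← LaurentPolynomial.invert_T, ← toLaurent_X,
    aeval_algHom_apply, ← coe_toLaurentAlg, aeval_algHom_apply, aeval_X_left_apply]

theorem toLaurent_aeval_y_eq_zero {g : K[X]} : toLaurent K (aeval (y K) g) = 0 ↔ g = 0 := by
  rw [toLaurent_aeval_y, EmbeddingLike.map_eq_zero_iff, Polynomial.toLaurent_eq_zero]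

theorem toLaurent_pStar (p : K[X]) : toLaurent K (aeval (y K) (pStar p)) =
    Polynomial.toLaurent p * LaurentPolynomial.T (-p.natDegree) := by
  rw [aeval_pStar, map_mul, toLaurent_aeval_x, map_pow, toLaurent_y, LaurentPolynomial.T_pow,
    mul_neg_one]

variable (K) in
theorem toLaurent_surjective : Function.Surjective (toLaurent K) := by
  intro g
  obtain ⟨n, f, hf⟩ := LaurentPolynomial.exists_T_pow g
  refine ⟨aeval (x K) f * y K ^ n, ?_⟩
  rw [map_mul, toLaurent_aeval_x, hf, map_pow, toLaurent_y, LaurentPolynomial.T_pow, mul_assoc,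
    ← LaurentPolynomial.T_add]
  simp

theorem exists_mul_y_pow_eq_aeval_y (r : JacobsonAlgebra K) :
    ∃ (N : ℕ) (g : K[X]), r * y K ^ N = aeval (y K) g := by
  induction r using induction with
  | algebraMap c => exact ⟨0, C c, by simp⟩
  | x => exact ⟨1, 1, by simp [x_mul_y]⟩
  | y => exact ⟨0, X, by simp⟩
  | add r s hr hs =>
    obtain ⟨M, g, hg⟩ := hr
    obtain ⟨N, h, hh⟩ := hs
    refine ⟨M + N, g * X ^ N + h * X ^ M, ?_⟩
    rw [add_mul, pow_add, ← mul_assoc, hg, ← pow_add, add_comm M N, pow_add, ← mul_assoc, hh]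
    simp
  | mul r s hr hs =>
    obtain ⟨M, g, hg⟩ := hr
    obtain ⟨N, h, hh⟩ := hs
    have hcomm : aeval (y K) h * y K ^ M = y K ^ M * aeval (y K) h := by
      rw [← aeval_X_pow (R := K), ← map_mul, ← map_mul, mul_comm]
    refine ⟨N + M, g * h, ?_⟩
    rw [pow_add, mul_assoc, ← mul_assoc s, hh, hcomm, ← mul_assoc, hg, map_mul]

theorem toLaurent_eq_zero_iff {r : JacobsonAlgebra K} :
    toLaurent K r = 0 ↔ ∃ N : ℕ, r * y K ^ N = 0 := by
  constructor
  · intro h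
    obtain ⟨N, g, hg⟩ := exists_mul_y_pow_eq_aeval_y r
    have hg0 : g = 0 := by rw [← toLaurent_aeval_y_eq_zero, ← hg, map_mul, h, zero_mul]
    exact ⟨N, by rw [hg, hg0, map_zero]⟩
  · rintro ⟨N, hN⟩
    have hy : IsUnit (toLaurent K (y K ^ N)) := by
      simpa using (LaurentPolynomial.isUnit_T (R := K) (-1)).pow N
    rw [← hy.mul_left_eq_zero, ← map_mul, hN, map_zero]

end Laurent

section LaurentModule

variable {K : Type u} [Field K]

theorem map_f₁_eq_zero_iff {A : Type*} [Ring A] [Algebra K A] {φ : JacobsonAlgebra K →ₐ[K] A} :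
    φ (f₁ K) = 0 ↔ φ (y K) * φ (x K) = 1 := by
  rw [f₁, map_sub, map_one, map_mul, sub_eq_zero, eq_comm]

theorem map_eq_zero_of_toLaurent_eq_zero {A : Type*} [Ring A] [Algebra K A]
    {φ : JacobsonAlgebra K →ₐ[K] A} (hφ : φ (f₁ K) = 0) {r : JacobsonAlgebra K}
    (hr : toLaurent K r = 0) : φ r = 0 := by
  obtain ⟨N, hN⟩ := toLaurent_eq_zero_iff.1 hr
  have hy : IsUnit (φ (y K)) :=
    ⟨⟨φ (y K), φ (x K), map_f₁_eq_zero_iff.1 hφ, by rw [← map_mul, x_mul_y, map_one]⟩, rfl⟩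
  rw [← (hy.pow N).mul_left_eq_zero, ← map_pow, ← map_mul, hN, map_zero]

variable {M : Type*} [AddCommGroup M] [Module (JacobsonAlgebra K) M] [Module K M]
  [IsScalarTower K (JacobsonAlgebra K) M]

theorem lsmul_f₁_eq_zero_of_finite [Module.Finite K M] : Algebra.lsmul K K M (f₁ K) = 0 := by
  rw [map_f₁_eq_zero_iff, mul_eq_one_comm, ← map_mul, x_mul_y, map_one]

/-- The Laurent polynomials act on a module over the Toeplitz–Jacobson algebra which is killed
by `f₁`. -/
def laurentAction (hM : Algebra.lsmul K K M (f₁ K) = 0) :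
    LaurentPolynomial K →ₐ[K] Module.End K M :=
  let φ : LaurentPolynomial K →+* Module.End K M :=
    (toLaurent K).toRingHom.liftOfSurjective (toLaurent_surjective K)
      ⟨(Algebra.lsmul K K M).toRingHom, fun _ => map_eq_zero_of_toLaurent_eq_zero hM⟩
  have hφ (r : JacobsonAlgebra K) : φ (toLaurent K r) = Algebra.lsmul K K M r :=
    (toLaurent K).toRingHom.liftOfSurjective_comp_apply _ _ r
  { φ with
    commutes' := fun c =>
      (congrArg φ ((toLaurent K).commutes c).symm).trans ((hφ _).trans (AlgHom.commutes _ c)) }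

theorem laurentAction_toLaurent (hM : Algebra.lsmul K K M (f₁ K) = 0) (r : JacobsonAlgebra K)
    (m : M) : laurentAction hM (toLaurent K r) m = r • m :=
  LinearMap.congr_fun ((toLaurent K).toRingHom.liftOfSurjective_comp_apply _ _ r) m

/-- The module structure over the Laurent polynomials given by `laurentAction`. -/
abbrev laurentModule (hM : Algebra.lsmul K K M (f₁ K) = 0) : Module (LaurentPolynomial K) M :=
  Module.compHom M (laurentAction hM).toRingHom

theorem isScalarTower_laurentModule (hM : Algebra.lsmul K K M (f₁ K) = 0) :
    letI := laurentModule hM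
    IsScalarTower K (LaurentPolynomial K) M :=
  letI := laurentModule hM
  ⟨fun c a m => LinearMap.congr_fun (map_smul (laurentAction hM) c a) m⟩

/-- The identity of `M`, semilinear over the quotient map to the Laurent polynomials. -/
def toLaurentModule (hM : Algebra.lsmul K K M (f₁ K) = 0) :
    letI := laurentModule hM
    M →ₛₗ[(toLaurent K).toRingHom] M :=
  letI := laurentModule hM
  { AddMonoidHom.id M with map_smul' := fun r m => (laurentAction_toLaurent hM r m).symm }

theorem finite_of_isFiniteLength_of_lsmul_f₁ (h : IsFiniteLength (JacobsonAlgebra K) M)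
    (hM : Algebra.lsmul K K M (f₁ K) = 0) : Module.Finite K M := by
  let := laurentModule hM
  have := isScalarTower_laurentModule hM
  have : RingHomSurjective (toLaurent K).toRingHom := ⟨toLaurent_surjective K⟩
  have hid : Function.Bijective (toLaurentModule hM) := Function.bijective_id
  have hL : IsFiniteLength (LaurentPolynomial K) M := by
    rwa [isFiniteLength_iff_isNoetherian_isArtinian,
      ← LinearMap.isNoetherian_iff_of_bijective _ hid,
      ← LinearMap.isArtinian_iff_of_bijective _ hid,
      ← isFiniteLength_iff_isNoetherian_isArtinian]
  exact finite_of_isFiniteLength hL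

end LaurentModule

section FiniteLength

variable {K : Type u} [Field K] {M : Type v} [AddCommGroup M] [Module (JacobsonAlgebra K) M]

theorem f₁_smul_mem_isotypicComponent (m : M) :
    f₁ K • m ∈ isotypicComponent (JacobsonAlgebra K) M (S₁ K) :=
  Submodule.map_le_isotypicComponent (S₁ K) (LinearMap.toSpanSingleton (JacobsonAlgebra K) M m)
    (Submodule.mem_map_of_mem (Submodule.mem_span_singleton_self (f₁ K)))

theorem finite_quotient_of_f₁_smul_mem (hM : IsFiniteLength (JacobsonAlgebra K) M)
    {N : Submodule (JacobsonAlgebra K) M} (hN : ∀ m, f₁ K • m ∈ N)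
    [Module K (M ⧸ N)] [IsScalarTower K (JacobsonAlgebra K) (M ⧸ N)] :
    Module.Finite K (M ⧸ N) := by
  obtain ⟨_, _⟩ := isFiniteLength_iff_isNoetherian_isArtinian.1 hM
  refine finite_of_isFiniteLength_of_lsmul_f₁
    (isFiniteLength_iff_isNoetherian_isArtinian.2 ⟨inferInstance, inferInstance⟩)
    (LinearMap.ext fun m => ?_)
  obtain ⟨m, rfl⟩ := N.mkQ_surjective m
  exact (Submodule.Quotient.mk_eq_zero N).2 (hN m)

variable (K) in
theorem exists_exact_of_isFiniteLength (hM : IsFiniteLength (JacobsonAlgebra K) M) :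
    ∃ (k : ℕ) (F : Type v) (_ : AddCommGroup F) (_ : Module (JacobsonAlgebra K) F)
      (_ : Module K F) (_ : IsScalarTower K (JacobsonAlgebra K) F)
      (ι : (Fin k → S₁ K) →ₗ[JacobsonAlgebra K] M) (π : M →ₗ[JacobsonAlgebra K] F),
      Function.Injective ι ∧ Function.Exact ι π ∧ Function.Surjective π ∧
        FiniteDimensional K F := by
  let N := isotypicComponent (JacobsonAlgebra K) M (S₁ K)
  obtain ⟨_, _⟩ := isFiniteLength_iff_isNoetherian_isArtinian.1 hM
  have hN : IsIsotypicOfType (JacobsonAlgebra K) N (S₁ K) := .isotypicComponent _ M (S₁ K)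
  obtain ⟨k, ⟨e⟩⟩ := hN.linearEquiv_fun
  let : Module K (M ⧸ N) := Module.restrictScalars K (JacobsonAlgebra K) (M ⧸ N)
  have : IsScalarTower K (JacobsonAlgebra K) (M ⧸ N) := IsScalarTower.restrictScalars _ _ _
  refine ⟨k, M ⧸ N, inferInstance, inferInstance, inferInstance, inferInstance,
    N.subtype ∘ₗ e.symm.toLinearMap, N.mkQ, N.injective_subtype.comp e.symm.injective, ?_,
    N.mkQ_surjective, finite_quotient_of_f₁_smul_mem hM f₁_smul_mem_isotypicComponent⟩
  rw [LinearMap.exact_iff, Submodule.ker_mkQ, LinearMap.range_comp, LinearEquiv.range,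
    Submodule.map_top, Submodule.range_subtype]

end FiniteLength

section FiniteDimensional

variable {K : Type u} [Field K] {F : Type w} [AddCommGroup F] [Module (JacobsonAlgebra K) F]
  [Module K F] [IsScalarTower K (JacobsonAlgebra K) F]

theorem exists_linearEquiv_pi_L [FiniteDimensional K F] :
    ∃ (n : ℕ) (p : Fin n → K[X]), (∀ i, p i ≠ 0) ∧
      Nonempty (F ≃ₗ[JacobsonAlgebra K] (∀ i, L (p i))) := by
  have hF : Algebra.lsmul K K F (f₁ K) = 0 := lsmul_f₁_eq_zero_of_finite
  let := laurentModule hF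
  have := isScalarTower_laurentModule hF
  obtain ⟨n, p, hp, ⟨e⟩⟩ := exists_linearEquiv_pi_quotient_toLaurent (K := K) (F := F)
  let eL : F →ₗ[JacobsonAlgebra K] ∀ i, L (p i) :=
    { toFun := e
      map_add' := map_add e
      map_smul' := fun r m =>
        (congrArg e (laurentAction_toLaurent hF r m).symm).trans (map_smul e (toLaurent K r) m) }
  exact ⟨n, p, hp, ⟨LinearEquiv.ofBijective eL e.bijective⟩⟩

end FiniteDimensional

section Ext

variable {K : Type u} [Field K]

theorem exists_eq_mul_aeval_y_of_toLaurent_eq_zero {q : K[X]} (hq : q.coeff 0 ≠ 0)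
    {r : JacobsonAlgebra K} (hr : toLaurent K r = 0) :
    ∃ u : K[X], r = r * aeval (y K) u * aeval (y K) q := by
  obtain ⟨N, hN⟩ := toLaurent_eq_zero_iff.1 hr
  have hcop : IsCoprime q (X ^ N) :=
    (irreducible_X.coprime_iff_not_dvd.2 (X_dvd_iff.not.2 hq)).symm.pow_right
  obtain ⟨u, v, huv⟩ := hcop
  have hrv : r * aeval (y K) (v * X ^ N) = 0 := by
    rw [mul_comm v, map_mul, aeval_X_pow, ← mul_assoc, hN, zero_mul]
  refine ⟨u, ?_⟩
  rw [mul_assoc, ← map_mul, ← add_zero (r * _), ← hrv, ← mul_add, ← map_add, huv, map_one, mul_one]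

theorem isRightRegular_aeval_y {q : K[X]} (hq : q.coeff 0 ≠ 0) :
    IsRightRegular (aeval (y K) q) := by
  refine isRightRegular_of_non_zero_divisor _ fun r hr => ?_
  have hq0 : toLaurent K (aeval (y K) q) ≠ 0 := by
    rw [Ne, toLaurent_aeval_y_eq_zero]
    rintro rfl
    exact hq (coeff_zero 0)
  have hr0 : toLaurent K r = 0 :=
    (mul_eq_zero.1 (by rw [← map_mul, hr, map_zero])).resolve_right hq0
  obtain ⟨u, hu⟩ := exists_eq_mul_aeval_y_of_toLaurent_eq_zero hq hr0
  rw [hu, mul_assoc, ← map_mul, mul_comm u, map_mul, ← mul_assoc, hr, zero_mul]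

theorem toLaurent_aeval_y_dvd_iff {q : K[X]} (hq : q.coeff 0 ≠ 0) {r : JacobsonAlgebra K} :
    toLaurent K (aeval (y K) q) ∣ toLaurent K r ↔ ∃ s, s * aeval (y K) q = r := by
  refine ⟨fun ⟨c, hc⟩ => ?_, fun ⟨s, hs⟩ => ⟨toLaurent K s, by rw [← hs, map_mul, mul_comm]⟩⟩
  obtain ⟨s, rfl⟩ := toLaurent_surjective K c
  have h0 : toLaurent K (r - s * aeval (y K) q) = 0 := by
    rw [map_sub, map_mul, hc, mul_comm, sub_self]
  obtain ⟨u, hu⟩ := exists_eq_mul_aeval_y_of_toLaurent_eq_zero hq h0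
  exact ⟨s + (r - s * aeval (y K) q) * aeval (y K) u, by rw [add_mul, ← hu, add_sub_cancel]⟩

theorem isOneRelator_L {p : K[X]} (hp : p ≠ 0) :
    IsOneRelator (aeval (y K) (pStar p)) (L.mk p 1) := by
  have hp0 : (pStar p).coeff 0 ≠ 0 := by simpa using hp
  have smul_mk_one (r : JacobsonAlgebra K) : r • L.mk p 1 = L.mk p (toLaurent K r) := by
    rw [L.smul_mk, mul_one]
  refine ⟨isRightRegular_aeval_y hp0, fun l => ?_, fun r => ?_⟩
  · obtain ⟨g, rfl⟩ := Ideal.Quotient.mk_surjective l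
    obtain ⟨r, rfl⟩ := toLaurent_surjective K g
    exact ⟨r, smul_mk_one r⟩
  · rw [smul_mk_one, ← toLaurent_aeval_y_dvd_iff hp0, toLaurent_pStar,
      (LaurentPolynomial.isUnit_T _).mul_right_dvd]
    exact Ideal.Quotient.eq_zero_iff_dvd _ _

theorem polyS₁Pow_mul {k : ℕ} (q : K[X]) (g : Fin k → K[X]) :
    polyS₁Pow K (fun i => q * g i) = aeval (y K) q • polyS₁Pow K g :=
  funext fun i => polyS₁_mul q (g i)

theorem polyS₁Pow_injective {k : ℕ} : Function.Injective (polyS₁Pow K (k := k)) :=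
  fun _ _ h => funext fun i => polyS₁_injective (congrFun h i)

theorem polyS₁Pow_surjective {k : ℕ} : Function.Surjective (polyS₁Pow K (k := k)) :=
  polyS₁_surjective.comp_left

/-- The extension class of `L_p` by `S₁^k` attached to a tuple of polynomials `g`: the pushout of
the resolution of `L_p` along the map `R → S₁^k` sending `1` to `g(y) f₁`. -/
def extOfPoly {p : K[X]} (hp : p ≠ 0) (k : ℕ) :
    (Fin k → K[X]) →ₗ[K] Abelian.Ext (LObj p) (SObj K k) 1 where
  toFun g := (isOneRelator_L hp).extMk (polyS₁Pow K g)
  map_add' g h := by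
    rw [← IsOneRelator.extMk_add]
    exact congrArg _ (funext fun i => polyS₁_add (g i) (h i))
  map_smul' c g := by
    rw [RingHom.id_apply, ← IsOneRelator.extMk_algebraMap_smul, ← aeval_C (y K), ← polyS₁Pow_mul]
    simp only [Pi.smul_def, smul_eq_C_mul]

theorem extOfPoly_apply {p : K[X]} (hp : p ≠ 0) {k : ℕ} (g : Fin k → K[X]) :
    extOfPoly hp k g = (isOneRelator_L hp).extMk (polyS₁Pow K g) := rfl

theorem extOfPoly_surjective {p : K[X]} (hp : p ≠ 0) (k : ℕ) :
    Function.Surjective (extOfPoly hp k) :=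
  (isOneRelator_L hp).extMk_surjective.comp polyS₁Pow_surjective

theorem extOfPoly_eq_zero_iff {p : K[X]} (hp : p ≠ 0) {k : ℕ} {g : Fin k → K[X]} :
    extOfPoly hp k g = 0 ↔ ∀ i, pStar p ∣ g i := by
  rw [extOfPoly_apply, IsOneRelator.extMk_eq_zero_iff, polyS₁Pow_surjective.exists]
  simp only [← polyS₁Pow_mul, polyS₁Pow_injective.eq_iff, funext_iff, dvd_def, Classical.skolem,
    eq_comm (b := g _)]

/-- `StarQuot.mk` as a `K`-linear map. -/
def starQuotMk (p : K[X]) (k : ℕ) : (Fin k → K[X]) →ₗ[K] StarQuot p k :=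
  LinearMap.pi fun i => (Ideal.Quotient.mkₐ K _).toLinearMap ∘ₗ LinearMap.proj i

theorem starQuotMk_surjective (p : K[X]) (k : ℕ) : Function.Surjective (starQuotMk p k) :=
  Ideal.Quotient.mk_surjective.comp_left

theorem ker_extOfPoly {p : K[X]} (hp : p ≠ 0) (k : ℕ) :
    LinearMap.ker (extOfPoly hp k) = LinearMap.ker (starQuotMk p k) := by
  ext g
  rw [LinearMap.mem_ker, LinearMap.mem_ker, extOfPoly_eq_zero_iff, funext_iff]
  exact forall_congr' fun i => (Ideal.Quotient.eq_zero_iff_dvd _ _).symm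

/-- The isomorphism `Θ_{p,k}`, which sends the class attached to `g` to `g mod p*`. -/
def extEquiv (p : K[X]) (hp : p ≠ 0) (k : ℕ) :
    Abelian.Ext (LObj p) (SObj K k) 1 ≃ₗ[K] StarQuot p k :=
  linearEquivOfKerEq (extOfPoly hp k) (starQuotMk p k) (extOfPoly_surjective hp k)
    (starQuotMk_surjective p k) (ker_extOfPoly hp k)

theorem extEquiv_eq_mk_iff {p : K[X]} (hp : p ≠ 0) {k : ℕ} {g : Fin k → K[X]}
    {c : Abelian.Ext (LObj p) (SObj K k) 1} :
    extEquiv p hp k c = StarQuot.mk p g ↔ c = (isOneRelator_L hp).extMk (polyS₁Pow K g) := by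
  have hg : extEquiv p hp k (extOfPoly hp k g) = StarQuot.mk p g := linearEquivOfKerEq_apply _ _ _ g
  rw [← hg, EmbeddingLike.apply_eq_iff_eq, extOfPoly_apply]

end Ext

end JacobsonAlgebra

end

theorem theorem4 (K : Type u) [Field K] :
    -- finite-length modules are extensions of finite-dimensional ones by powers of `S₁`
    (∀ (M : Type v) [AddCommGroup M] [Module (JacobsonAlgebra K) M],
      IsFiniteLength (JacobsonAlgebra K) M →
      ∃ (k : ℕ) (F : Type v) (_ : AddCommGroup F) (_ : Module (JacobsonAlgebra K) F)
        (_ : Module K F) (_ : IsScalarTower K (JacobsonAlgebra K) F)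
        (ι : (Fin k → JacobsonAlgebra.S₁ K) →ₗ[JacobsonAlgebra K] M)
        (π : M →ₗ[JacobsonAlgebra K] F),
        Function.Injective ι ∧ Function.Exact ι π ∧ Function.Surjective π ∧
          FiniteDimensional K F) ∧
    -- finite-dimensional modules are direct sums of modules `L_p`
    (∀ (F : Type w) [AddCommGroup F] [Module (JacobsonAlgebra K) F] [Module K F]
      [IsScalarTower K (JacobsonAlgebra K) F] [FiniteDimensional K F],
      ∃ (n : ℕ) (p : Fin n → K[X]), (∀ i, p i ≠ 0) ∧
        Nonempty (F ≃ₗ[JacobsonAlgebra K] (∀ i, JacobsonAlgebra.L (p i)))) ∧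
    -- the natural identification of the Ext spaces
    ∃ Θ : ∀ (p : K[X]), p ≠ 0 → ∀ k : ℕ,
        Abelian.Ext (JacobsonAlgebra.LObj p) (JacobsonAlgebra.SObj K k) 1 ≃ₗ[K]
          JacobsonAlgebra.StarQuot p k,
      -- value on the class of an extension `0 → S₁^k → E → L_p → 0`
      (∀ (p : K[X]) (hp : p ≠ 0) (k : ℕ) (E : ModuleCat.{u} (JacobsonAlgebra K))
        (ι : JacobsonAlgebra.SObj K k ⟶ E) (π : E ⟶ JacobsonAlgebra.LObj p)
        (hιπ : ι ≫ π = 0) (hE : (ShortComplex.mk ι π hιπ).ShortExact)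
        (e : E) (g : Fin k → K[X]),
        π.hom e = JacobsonAlgebra.L.mk p 1 →
        ι.hom (JacobsonAlgebra.polyS₁Pow K g) =
          aeval (JacobsonAlgebra.y K) (JacobsonAlgebra.pStar p) • e →
        Θ p hp k hE.extClass = JacobsonAlgebra.StarQuot.mk p g) ∧
      -- naturality in `S₁^k`
      (∀ (p : K[X]) (hp : p ≠ 0) (k l : ℕ)
        (α : JacobsonAlgebra.SObj K k ⟶ JacobsonAlgebra.SObj K l)
        (c : Abelian.Ext (JacobsonAlgebra.LObj p) (JacobsonAlgebra.SObj K k) 1)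
        (g : Fin k → K[X]) (h : Fin l → K[X]),
        α.hom (JacobsonAlgebra.polyS₁Pow K g) = JacobsonAlgebra.polyS₁Pow K h →
        Θ p hp k c = JacobsonAlgebra.StarQuot.mk p g →
        Θ p hp l (c.comp (Abelian.Ext.mk₀ α) (add_zero 1)) = JacobsonAlgebra.StarQuot.mk p h) ∧
      -- naturality in `L_p`
      (∀ (p q : K[X]) (hp : p ≠ 0) (hq : q ≠ 0) (k : ℕ)
        (β : JacobsonAlgebra.LObj p ⟶ JacobsonAlgebra.LObj q)
        (c : Abelian.Ext (JacobsonAlgebra.LObj q) (JacobsonAlgebra.SObj K k) 1)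
        (a b : K[X]) (g : Fin k → K[X]),
        β.hom (JacobsonAlgebra.L.mk p 1) =
          aeval (JacobsonAlgebra.y K) a • JacobsonAlgebra.L.mk q 1 →
        a * JacobsonAlgebra.pStar p = b * JacobsonAlgebra.pStar q →
        Θ q hq k c = JacobsonAlgebra.StarQuot.mk q g →
        Θ p hp k ((Abelian.Ext.mk₀ β).comp c (zero_add 1)) =
          JacobsonAlgebra.StarQuot.mk p (fun i => b * g i)) := by
  refine ⟨fun M _ _ hM => JacobsonAlgebra.exists_exact_of_isFiniteLength K hM,
    fun F _ _ _ _ _ => JacobsonAlgebra.exists_linearEquiv_pi_L,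
    JacobsonAlgebra.extEquiv, ?_, ?_, ?_⟩
  · intro p hp k E ι π hιπ hE e g he hg
    rw [JacobsonAlgebra.extEquiv_eq_mk_iff]
    exact (JacobsonAlgebra.isOneRelator_L hp).extClass_eq_extMk hE he hg
  · intro p hp k l α c g h hα hc
    rw [JacobsonAlgebra.extEquiv_eq_mk_iff] at hc ⊢
    rw [hc, IsOneRelator.extMk_comp_mk₀, hα]
  · intro p q hp hq k β c a b g hβ hab hc
    have hba : aeval (JacobsonAlgebra.y K) (b * JacobsonAlgebra.pStar q) =
        aeval (JacobsonAlgebra.y K) (JacobsonAlgebra.pStar p * a) := by rw [← hab, mul_comm]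
    rw [map_mul, map_mul] at hba
    rw [JacobsonAlgebra.extEquiv_eq_mk_iff] at hc ⊢
    rw [hc, JacobsonAlgebra.polyS₁Pow_mul]
    exact (JacobsonAlgebra.isOneRelator_L hp).mk₀_comp_extMk _ hβ hba _
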